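/- Let $X, Y$ be Polish spaces, let $E$ be a Borel equivalence relation on $X$, and let $P \subseteq X \times Y$ be a Borel set that is $E$-invariant, i.e. $x_1 \mathrel{E} x_2$ implies $P_{x_1} = P_{x_2}$, where $P_x = \{y \in Y : (x,y) \in P\}$. Suppose that one of the following holds: (i) there is a Borel $E$-invariant assignment $x \mapsto \mu_x$ of Borel probability measures $\mu_x$ on $Y$ (that is, $x \mapsto \mu_x(A)$ is Borel for every Borel $A \subseteq Y$, and $x_1 \mathrel{E} x_2$ implies $\mu_{x_1} = \mu_{x_2}$) such that, for all $x \in X$, $P_x$ is $\mathbf{\Delta}^0_2$ (both $F_\sigma$ and $G_\delta$) and $\mu_x(P_x) > 0$; (ii) for all $x \in X$, $P_x$ is $F_\sigma$ and non-meager in $Y$; (iii) for all $x \in X$, $P_x$ is $G_\delta$, non-empty and $K_\sigma$ (a countable union of compact sets; in particular, this covers $P_x$ non-empty, countable and $G_\delta$). Then $P$ has a Borel $E$-invariant uniformization, i.e. there is a Borel function $f : X \to Y$ such that $(x, f(x)) \in P$ for all $x \in X$, and $x_1 \mathrel{E} x_2$ implies $f(x_1) = f(x_2)$. -/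

import Mathlib

open MeasureTheory

namespace InvUnif

/-- A set is `F_σ` if it is the union of a sequence of closed sets. -/
def IsFSigma {Y : Type*} [TopologicalSpace Y] (s : Set Y) : Prop :=
  ∃ F : ℕ → Set Y, (∀ n, IsClosed (F n)) ∧ s = ⋃ n, F n

/-- The boldface pointclass `Δ⁰₂`: the sets that are both `F_σ` and `G_δ`. -/
def IsDeltaTwo {Y : Type*} [TopologicalSpace Y] (s : Set Y) : Prop :=
  IsFSigma s ∧ IsGδ s

/-- The section `P_x = {y : (x, y) ∈ P}`. -/
def sec {X Y : Type*} (P : Set (X × Y)) (x : X) : Set Y :=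
  {y | (x, y) ∈ P}

/-- `E` is a Borel equivalence relation: its graph is a Borel subset of `X × X`. For a second
countable `X` with its Borel structure, the product σ-algebra is the Borel σ-algebra of `X × X`. -/
def IsBorelEquiv {X : Type*} [MeasurableSpace X] (E : Setoid X) : Prop :=
  MeasurableSet {p : X × X | E p.1 p.2}

/-- A map `g` on `X` is `E`-invariant if it is constant on every `E`-class. -/
def IsInvariantMap {X Z : Type*} (E : Setoid X) (g : X → Z) : Prop :=
  ∀ x₁ x₂ : X, E x₁ x₂ → g x₁ = g x₂

/-- `P ⊆ X × Y` is `E`-invariant if `x₁ E x₂` implies `P_{x₁} = P_{x₂}`. -/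
def IsInvariantSet {X Y : Type*} (E : Setoid X) (P : Set (X × Y)) : Prop :=
  ∀ x₁ x₂ : X, E x₁ x₂ → sec P x₁ = sec P x₂

/-- `f` is a Borel `E`-invariant uniformization of `P`. -/
structure IsBorelInvariantUniformization {X Y : Type*} [MeasurableSpace X] [MeasurableSpace Y]
    (E : Setoid X) (P : Set (X × Y)) (f : X → Y) : Prop where
  measurable : Measurable f
  mem : ∀ x : X, (x, f x) ∈ P
  invariant : IsInvariantMap E f

end InvUnif

namespace InvUnif

open Set Filter Topology

/-! All three cases rest on one scheme. To each `x` attach, invariantly, a closed set `K x` having a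
nonempty relatively open part inside `P x`: the whole space in (ii), the support of `μ x` restricted
to `P x` in (i), the closure of `P x` in a compactification in (iii). Baire category, or
non-meagerness in (ii), yields such a part. If one basic open `V n` could be chosen for each class
in a Borel way, with `K x` meeting `V n` and `K x ∩ closure (V n) ⊆ P x`, then
Kuratowski–Ryll-Nardzewski on the quotient would finish.

The good `n` for `x` are given by `x ∈ R n \ R' n` with `R n`, `R' n` analytic, so the choice needs
a Borel reduction of this cover. It comes from a fusion (forcing with positive analytic sets): if
the σ-ideal generated by the sets `C ∩ R n`, with `C` Borel and disjoint from `R' n`, were proper, a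
generic point would lie in no `R n \ R' n`. Invariance is added by alternating saturation and Lusin
separation. -/

theorem AnalyticSet.inter {X : Type*} [TopologicalSpace X] [T2Space X] {s t : Set X}
    (hs : AnalyticSet s) (ht : AnalyticSet t) : AnalyticSet (s ∩ t) := by
  rw [inter_eq_iInter]
  exact AnalyticSet.iInter (by rintro (_ | _) <;> assumption)

theorem AnalyticSet.diff_measurableSet {X : Type*} [TopologicalSpace X] [PolishSpace X]
    [MeasurableSpace X] [BorelSpace X] {s t : Set X} (hs : AnalyticSet s) (ht : MeasurableSet t) :
    AnalyticSet (s \ t) :=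
  AnalyticSet.inter hs ht.compl.analyticSet

/-! ### Fusion for σ-ideals on analytic sets. -/

section Generic

variable {X : Type*} [TopologicalSpace X]

/-- A stage of the fusion argument for analytic sets that are positive for an ideal `I`. -/
structure FusionStage (I : Set X → Prop) where
  carrier : Set X
  analytic : AnalyticSet carrier
  positive : ¬ I carrier
  param : ℕ → (ℕ → ℕ) → X
  continuous_param : ∀ i, Continuous (param i)
  dom : ℕ → Set (ℕ → ℕ)
  isClosed_dom : ∀ i, IsClosed (dom i)
  subset_image : ∀ i, carrier ⊆ param i '' dom i

/-- Splitting by the values of finitely many coordinates of finitely many codes gives countably many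
analytic pieces, so one is positive. Fixing those coordinates forces the codes to converge, which
replaces compactness in the fusion. -/
theorem FusionStage.exists_next [T2Space X] {I : Set X → Prop} (empty : I ∅)
    (mono : ∀ s t, s ⊆ t → I t → I s)
    (iUnion : ∀ s : ℕ → Set X, (∀ n, I (s n)) → I (⋃ n, s n))
    {Q : ℕ → Set X → Prop}
    (dense : ∀ n W, AnalyticSet W → ¬ I W → ∃ W' ⊆ W, AnalyticSet W' ∧ ¬ I W' ∧ Q n W')
    (k : ℕ) (S : FusionStage I) :
    ∃ S' : FusionStage I,
      (∀ i < k, S'.param i = S.param i ∧ S'.dom i ⊆ S.dom i) ∧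
      Q k (range (S'.param k)) ∧
      ∀ i ≤ k, ∀ j ≤ k, ∃ c, ∀ z ∈ S'.dom i, z j = c := by
  obtain ⟨W, hWS, hW, hWI, hWQ⟩ := dense k S.carrier S.analytic S.positive
  have hne : W ≠ ∅ := by
    rintro rfl
    exact hWI empty
  obtain ⟨f, hf, rfl⟩ := (AnalyticSet_def W ▸ hW).resolve_left hne
  -- Only indices up to `k` matter after this stage; the later ones are fillers that the next stages
  -- overwrite.
  let F : ℕ → (ℕ → ℕ) → X := fun i => if i < k then S.param i else f
  let G : ℕ → Set (ℕ → ℕ) := fun i => if i < k then S.dom i else univ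
  have hF : ∀ i, Continuous (F i) := fun i => by
    by_cases h : i < k <;> simp [F, h, hf, S.continuous_param]
  have hG : ∀ i, IsClosed (G i) := fun i => by
    by_cases h : i < k <;> simp [G, h, S.isClosed_dom]
  have hFG : ∀ i, range f ⊆ F i '' G i := fun i => by
    by_cases h : i < k
    · simpa [F, G, h] using hWS.trans (S.subset_image i)
    · simp [F, G, h]
  let T := Fin (k + 1) → Fin (k + 1) → ℕ
  let G' : T → ℕ → Set (ℕ → ℕ) := fun t i =>
    G i ∩ ⋂ (hi : i < k + 1) (j : Fin (k + 1)), {z | z j = t ⟨i, hi⟩ j}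
  have hG' : ∀ t i, IsClosed (G' t i) := fun t i =>
    (hG i).inter <| isClosed_iInter fun _ => isClosed_iInter fun j =>
      isClosed_eq (continuous_apply _) continuous_const
  let W' : T → Set X := fun t => range f ∩ ⋂ i, F i '' G' t i
  have hcover : range f ⊆ ⋃ t, W' t := by
    intro w hw
    choose z hz hzw using fun i => hFG i hw
    refine mem_iUnion.2 ⟨fun i j => z i j, hw, mem_iInter.2 fun i => ⟨z i, ⟨hz i, ?_⟩, hzw i⟩⟩
    simp
  obtain ⟨t, ht⟩ : ∃ t, ¬ I (W' t) := by
    by_contra! h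
    obtain ⟨e, he⟩ := exists_surjective_nat T
    refine hWI (mono _ _ hcover ?_)
    rw [← he.iUnion_comp]
    exact iUnion _ fun n => h _
  refine ⟨⟨W' t, AnalyticSet.inter hW (AnalyticSet.iInter fun i =>
    (hG' t i).analyticSet.image_of_continuous (hF i)), ht, F, hF, G' t, hG' t,
    fun i => inter_subset_right.trans (iInter_subset _ i)⟩, ?_, ?_, ?_⟩
  · intro i hi
    refine ⟨by simp [F, hi], inter_subset_left.trans (by simp [G, hi])⟩
  · simpa [F] using hWQ
  · intro i hi j hj
    refine ⟨t ⟨i, by omega⟩ ⟨j, by omega⟩, fun z hz => ?_⟩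
    have := hz.2
    simp only [mem_iInter, mem_ofPred_eq] at this
    exact this (by omega) ⟨j, by omega⟩

/-- Fusion for analytic sets that are positive for a `σ`-ideal: countably many dense requirements
can be met along a sequence of analytic sets with a common point. -/
theorem exists_mem_forall_of_dense [T2Space X] {I : Set X → Prop} (empty : I ∅)
    (mono : ∀ s t, s ⊆ t → I t → I s)
    (iUnion : ∀ s : ℕ → Set X, (∀ n, I (s n)) → I (⋃ n, s n))
    {Q : ℕ → Set X → Prop}
    (dense : ∀ n W, AnalyticSet W → ¬ I W → ∃ W' ⊆ W, AnalyticSet W' ∧ ¬ I W' ∧ Q n W')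
    {W₀ : Set X} (hW₀ : AnalyticSet W₀) (hI : ¬ I W₀) :
    ∃ x, ∀ n, ∃ W, x ∈ W ∧ Q n W := by
  obtain ⟨f, hf, hfW⟩ := (AnalyticSet_def W₀ ▸ hW₀).resolve_left (by rintro rfl; exact hI empty)
  let S₀ : FusionStage I := ⟨W₀, hW₀, hI, fun _ => f, fun _ => hf, fun _ => univ,
    fun _ => isClosed_univ, fun _ => by simp [hfW]⟩
  choose next h₁ h₂ h₃ using FusionStage.exists_next empty mono iUnion dense
  let S : ℕ → FusionStage I := fun k => Nat.rec S₀ next k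
  -- Parametrization `i` is installed at stage `i + 1` and never changes afterwards; only its domain
  -- shrinks.
  have hparam : ∀ i m, (S (i + 1 + m)).param i = (S (i + 1)).param i ∧
      (S (i + 1 + m)).dom i ⊆ (S (i + 1)).dom i := by
    intro i m
    induction m with
    | zero => exact ⟨rfl, subset_rfl⟩
    | succ m ih =>
      have := h₁ (i + 1 + m) (S (i + 1 + m)) i (by omega)
      exact ⟨this.1.trans ih.1, this.2.trans ih.2⟩
  have hdom : ∀ i m k, i < k → (S (k + m)).dom i ⊆ (S k).dom i := by
    intro i m k hik
    induction m with
    | zero => exact subset_rfl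
    | succ m ih => exact (h₁ (k + m) (S (k + m)) i (by omega)).2.trans ih
  have hne : ∀ k, (S k).carrier.Nonempty := fun k => by
    by_contra h
    exact (S k).positive (not_nonempty_iff_eq_empty.1 h ▸ empty)
  choose w hw using hne
  have hlim : ∀ i, ∃ z, Tendsto w atTop (𝓝 ((S (i + 1)).param i z)) := by
    intro i
    choose z hz hzw using fun k => (S k).subset_image i (hw k)
    have hconst : ∀ j, ∃ c, ∀ᶠ k in atTop, z k j = c := by
      intro j
      obtain ⟨c, hc⟩ := h₃ (max i j) (S (max i j)) i (le_max_left _ _) j (le_max_right _ _)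
      refine ⟨c, eventually_atTop.2 ⟨max i j + 1, fun k hk => hc _ ?_⟩⟩
      obtain ⟨m, rfl⟩ := Nat.exists_eq_add_of_le hk
      exact hdom i m (max i j + 1) (by omega) (hz _)
    choose c hc using hconst
    refine ⟨c, ?_⟩
    have hzc : Tendsto z atTop (𝓝 c) :=
      tendsto_pi_nhds.2 fun j => tendsto_nhds_of_eventually_eq (hc j)
    refine ((((S (i + 1)).continuous_param i).tendsto c).comp hzc).congr' ?_
    filter_upwards [eventually_ge_atTop (i + 1)] with k hk
    obtain ⟨m, rfl⟩ := Nat.exists_eq_add_of_le hk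
    rw [Function.comp_apply, ← (hparam i m).1, hzw]
  choose z hz using hlim
  refine ⟨(S 1).param 0 (z 0), fun n => ⟨range ((S (n + 1)).param n), ⟨z n, ?_⟩, h₂ n (S n)⟩⟩
  -- Every `param n (z n)` is a limit of the same sequence `w`, so these points coincide.
  exact tendsto_nhds_unique (hz n) (hz 0)

end Generic

/-! ### Borel reduction of a cover by differences of analytic sets. -/

section Separation

variable {X : Type*} [TopologicalSpace X] [PolishSpace X] [MeasurableSpace X] [BorelSpace X]

/-- A cover by differences `R n \ R' n` of analytic sets can be refined to a cover by Borel sets,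
provided that every `R n` is Borel on each Borel set that misses `R' n`. -/
theorem exists_measurableSet_disjoint_iUnion_inter_eq_univ {R R' : ℕ → Set X}
    (hR : ∀ n, AnalyticSet (R n)) (hR' : ∀ n, AnalyticSet (R' n))
    (hcover : ∀ x, ∃ n, x ∈ R n ∧ x ∉ R' n)
    (hmeas : ∀ n C, MeasurableSet C → Disjoint C (R' n) → MeasurableSet (C ∩ R n)) :
    ∃ C : ℕ → Set X, (∀ n, MeasurableSet (C n) ∧ Disjoint (C n) (R' n)) ∧
      ⋃ n, C n ∩ R n = univ := by
  let I : Set X → Prop := fun Z => ∃ C : ℕ → Set X,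
    (∀ n, MeasurableSet (C n) ∧ Disjoint (C n) (R' n)) ∧ Z ⊆ ⋃ n, C n ∩ R n
  have empty : I ∅ := ⟨fun _ => ∅, fun _ => ⟨.empty, empty_disjoint _⟩, empty_subset _⟩
  have mono : ∀ s t, s ⊆ t → I t → I s := fun s t hst ⟨C, hC, ht⟩ => ⟨C, hC, hst.trans ht⟩
  have iUnion : ∀ s : ℕ → Set X, (∀ n, I (s n)) → I (⋃ n, s n) := by
    intro s hs
    choose C hC hsC using hs
    refine ⟨fun n => ⋃ m, C m n, fun n => ⟨.iUnion fun m => (hC m n).1,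
      disjoint_iUnion_left.2 fun m => (hC m n).2⟩, iUnion_subset fun m => (hsC m).trans ?_⟩
    exact iUnion_mono fun n => inter_subset_inter_left _ (subset_iUnion (fun m => C m n) m)
  have union : ∀ s t, I s → I t → I (s ∪ t) := by
    intro s t hs ht
    refine mono _ _ ?_ (iUnion (fun n => if n = 0 then s else t) fun n => by
      by_cases h : n = 0 <;> simp [h, hs, ht])
    exact union_subset (subset_iUnion_of_subset 0 (by simp)) (subset_iUnion_of_subset 1 (by simp))
  -- This is where `hmeas` enters: sets in the ideal have Borel hulls in it, so removing a hull from
  -- an analytic set leaves an analytic set.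
  have hull : ∀ s, I s → ∃ D, MeasurableSet D ∧ I D ∧ s ⊆ D := fun s ⟨C, hC, hs⟩ =>
    ⟨_, .iUnion fun n => hmeas n _ (hC n).1 (hC n).2, ⟨C, hC, subset_rfl⟩, hs⟩
  have single : ∀ n C, MeasurableSet C → Disjoint C (R' n) → I (C ∩ R n) := by
    intro n C hC hd
    refine ⟨fun m => if m = n then C else ∅, fun m => ?_, subset_iUnion_of_subset n (by simp)⟩
    by_cases h : m = n
    · subst h; simp [hC, hd]
    · simp [h]
  suffices h : I univ by
    obtain ⟨C, hC, hu⟩ := h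
    exact ⟨C, hC, univ_subset_iff.1 hu⟩
  by_contra hu
  have dense : ∀ n W, AnalyticSet W → ¬ I W → ∃ W' ⊆ W, AnalyticSet W' ∧ ¬ I W' ∧
      (W' ⊆ R' n ∨ Disjoint W' (R n)) := by
    intro n W hW hWI
    by_cases h : I (W ∩ R n)
    · obtain ⟨D, hD, hDI, hWD⟩ := hull _ h
      refine ⟨W \ D, sdiff_subset, AnalyticSet.diff_measurableSet hW hD, fun h' => hWI ?_,
        Or.inr (disjoint_left.2 fun x hx hx' => hx.2 (hWD ⟨hx.1, hx'⟩))⟩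
      exact mono _ _ (by rw [sdiff_union_self]; exact subset_union_left) (union _ _ h' hDI)
    · refine ⟨W ∩ R n ∩ R' n, inter_subset_left.trans inter_subset_left,
        AnalyticSet.inter (AnalyticSet.inter hW (hR n)) (hR' n), fun h' => h ?_,
        Or.inl inter_subset_right⟩
      -- If `W ∩ R n ∩ R' n` were small, then off its hull `W ∩ R n` would be separated from `R' n`
      -- by a Borel set, making `W ∩ R n` itself small.
      obtain ⟨D, hD, hDI, hWD⟩ := hull _ h'
      obtain ⟨C, hC, hCd, hCm⟩ := AnalyticSet.measurablySeparable
        (AnalyticSet.diff_measurableSet (AnalyticSet.inter hW (hR n)) hD) (hR' n)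
        (disjoint_left.2 fun x hx hx' => hx.2 (hWD ⟨hx.1, hx'⟩))
      refine mono _ _ ?_ (union _ _ (single n C hCm hCd.symm) hDI)
      intro x hx
      by_cases hxD : x ∈ D
      · exact Or.inr hxD
      · exact Or.inl ⟨hC ⟨hx, hxD⟩, hx.2⟩
  obtain ⟨x, hx⟩ := exists_mem_forall_of_dense empty mono iUnion dense
    MeasurableSet.univ.analyticSet hu
  obtain ⟨n, hn, hn'⟩ := hcover x
  obtain ⟨W, hxW, h | h⟩ := hx n
  · exact hn' (h hxW)
  · exact disjoint_left.1 h hxW hn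

end Separation
theorem exists_seq_isOpen_closure_subset (Y : Type*) [TopologicalSpace Y]
    [SecondCountableTopology Y] [RegularSpace Y] :
    ∃ V : ℕ → Set Y, (∀ n, IsOpen (V n)) ∧
      ∀ U, IsOpen U → ∀ y ∈ U, ∃ n, y ∈ V n ∧ closure (V n) ⊆ U := by
  -- Inserting `∅` keeps the family nonempty, hence enumerable by `ℕ`, even when `Y` is empty.
  obtain ⟨V, hV⟩ := ((TopologicalSpace.countable_countableBasis Y).insert ∅).exists_eq_range
    (insert_nonempty _ _)
  have hopen : ∀ n, IsOpen (V n) := fun n => by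
    rcases hV ▸ mem_range_self n with h | h
    · exact h ▸ isOpen_empty
    · exact TopologicalSpace.isOpen_of_mem_countableBasis h
  refine ⟨V, hopen, fun U hU y hy => ?_⟩
  obtain ⟨t, ht, htc, htU⟩ := exists_mem_nhds_isClosed_subset (hU.mem_nhds hy)
  obtain ⟨v, hv, hyv, hvt⟩ :=
    (TopologicalSpace.isBasis_countableBasis Y).mem_nhds_iff.1 ht
  obtain ⟨n, rfl⟩ : v ∈ range V := hV ▸ Or.inr hv
  exact ⟨n, hyv, (closure_minimal hvt htc).trans htU⟩

/-! ### Projections of analytic sets. -/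

section Analytic

variable {X Y : Type*} [TopologicalSpace X] [TopologicalSpace Y]

theorem AnalyticSet.union {s t : Set X} (hs : AnalyticSet s) (ht : AnalyticSet t) :
    AnalyticSet (s ∪ t) := by
  rw [union_eq_iUnion]
  exact AnalyticSet.iUnion (by rintro (_ | _) <;> assumption)

theorem AnalyticSet.nonempty_sec {Q : Set (X × Y)} (hQ : AnalyticSet Q) :
    AnalyticSet {x | (sec Q x).Nonempty} := by
  convert! hQ.image_of_continuous continuous_fst using 1
  ext x
  exact ⟨fun ⟨y, hy⟩ => ⟨(x, y), hy, rfl⟩, by rintro ⟨⟨x, y⟩, hy, rfl⟩; exact ⟨y, hy⟩⟩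

theorem AnalyticSet.nonempty_sec_inter [PolishSpace X] [PolishSpace Y] {Q : Set (X × Y)}
    (hQ : AnalyticSet Q) {U : Set Y}
    (hU : AnalyticSet U) : AnalyticSet {x | (sec Q x ∩ U).Nonempty} :=
  AnalyticSet.nonempty_sec (AnalyticSet.inter hQ (hU.preimage continuous_snd))

end Analytic

/-! ### Invariant separation and invariant covers. -/

section Invariant

variable {X : Type*} [TopologicalSpace X] [PolishSpace X] [MeasurableSpace X] [BorelSpace X]
  {E : Setoid X}

/-- Two disjoint analytic sets, one of which is invariant under a Borel equivalence relation, are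
separated by an invariant Borel set. -/
theorem exists_measurableSet_invariant_separating (hE : IsBorelEquiv E) {A B : Set X}
    (hA : AnalyticSet A) (hB : AnalyticSet B) (hBE : ∀ x y, E x y → y ∈ B → x ∈ B)
    (h : Disjoint A B) :
    ∃ C, MeasurableSet C ∧ A ⊆ C ∧ Disjoint C B ∧ ∀ x y, E x y → x ∈ C → y ∈ C := by
  obtain ⟨C₀, hAC, hBC, hC₀⟩ := hA.measurablySeparable hB h
  -- The saturation of `C` is analytic and still misses the invariant set `B`, so a Borel set
  -- separates them. The union of the iterates is invariant.
  have step : ∀ C : {C : Set X // MeasurableSet C ∧ Disjoint C B},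
      ∃ C' : {C : Set X // MeasurableSet C ∧ Disjoint C B},
        ∀ x y, E x y → x ∈ C.1 → y ∈ C'.1 := by
    rintro ⟨C, hC, hCB⟩
    have hsat : AnalyticSet {y | ∃ x ∈ C, E x y} := by
      convert! (AnalyticSet.inter (MeasurableSet.analyticSet hE)
        ((hC.analyticSet).preimage continuous_fst)).image_of_continuous continuous_snd using 1
      ext y
      exact ⟨fun ⟨x, hx, hxy⟩ => ⟨(x, y), ⟨hxy, hx⟩, rfl⟩,
        by rintro ⟨⟨x, y⟩, ⟨hxy, hx⟩, rfl⟩; exact ⟨x, hx, hxy⟩⟩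
    obtain ⟨D, hD, hDB, hDm⟩ := hsat.measurablySeparable hB (disjoint_left.2
      fun y ⟨x, hx, hxy⟩ hy => disjoint_left.1 hCB hx (hBE x y hxy hy))
    exact ⟨⟨D, hDm, hDB.symm⟩, fun x y hxy hx => hD ⟨x, hx, hxy⟩⟩
  choose next hnext using step
  let C : ℕ → {C : Set X // MeasurableSet C ∧ Disjoint C B} :=
    fun n => Nat.rec ⟨C₀, hC₀, hBC.symm⟩ (fun _ => next) n
  refine ⟨⋃ n, (C n).1, .iUnion fun n => (C n).2.1, hAC.trans (subset_iUnion (fun n => (C n).1) 0),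
    disjoint_iUnion_left.2 fun n => (C n).2.2, fun x y hxy hx => ?_⟩
  obtain ⟨n, hn⟩ := mem_iUnion.1 hx
  exact mem_iUnion.2 ⟨n + 1, hnext _ x y hxy hn⟩

/-- The Borel sets from the reduction need not be invariant; each is enlarged to an invariant one
still missing `R' n`, and `hmeas` makes its trace on `R n` Borel. -/
theorem exists_measurableSet_invariant_cover (hE : IsBorelEquiv E) {R R' : ℕ → Set X}
    (hR : ∀ n, AnalyticSet (R n)) (hR' : ∀ n, AnalyticSet (R' n))
    (hRE : ∀ n x y, E x y → x ∈ R n → y ∈ R n) (hRE' : ∀ n x y, E x y → x ∈ R' n → y ∈ R' n)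
    (hcover : ∀ x, ∃ n, x ∈ R n ∧ x ∉ R' n)
    (hmeas : ∀ n C, MeasurableSet C → Disjoint C (R' n) → MeasurableSet (C ∩ R n)) :
    ∃ B : ℕ → Set X, (∀ n, MeasurableSet (B n) ∧ B n ⊆ R n ∧ Disjoint (B n) (R' n) ∧
      ∀ x y, E x y → x ∈ B n → y ∈ B n) ∧ ∀ x, ∃ n, x ∈ B n := by
  obtain ⟨C, hC, hCu⟩ := exists_measurableSet_disjoint_iUnion_inter_eq_univ hR hR' hcover hmeas
  choose D hD hCD hDd hDE using fun n => exists_measurableSet_invariant_separating hE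
    (hC n).1.analyticSet (hR' n) (fun x y h => hRE' n y x (E.symm h)) (hC n).2
  refine ⟨fun n => D n ∩ R n, fun n => ⟨hmeas n _ (hD n) (hDd n), inter_subset_right,
    (hDd n).mono_left inter_subset_left, fun x y h hx => ⟨hDE n x y h hx.1, hRE n x y h hx.2⟩⟩,
    fun x => ?_⟩
  obtain ⟨n, hn⟩ := mem_iUnion.1 (hCu ▸ mem_univ x)
  exact ⟨n, hCD n hn.1, hn.2⟩

end Invariant

/-! ### Borel sets with open or compact sections. -/

section Projection

/-- Novikov's separation theorem, in its dual form. -/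
theorem exists_measurableSet_disjoint_iUnion_eq_univ {X : Type*} [TopologicalSpace X]
    [PolishSpace X] [MeasurableSpace X] [BorelSpace X] {A : ℕ → Set X}
    (hA : ∀ n, AnalyticSet (A n)) (h : ⋂ n, A n = ∅) :
    ∃ C : ℕ → Set X, (∀ n, MeasurableSet (C n) ∧ Disjoint (C n) (A n)) ∧ ⋃ n, C n = univ := by
  obtain ⟨C, hC, hCu⟩ := exists_measurableSet_disjoint_iUnion_inter_eq_univ
    (R := fun _ => univ) (fun _ => MeasurableSet.univ.analyticSet) hA
    (fun x => by simpa using (h ▸ notMem_empty x : x ∉ ⋂ n, A n))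
    (fun n C hC _ => by simpa using hC)
  exact ⟨C, hC, by simpa using hCu⟩

variable {X Y : Type*} [TopologicalSpace X] [PolishSpace X] [MeasurableSpace X] [BorelSpace X]
  [TopologicalSpace Y] [PolishSpace Y] [MeasurableSpace Y] [BorelSpace Y]

/-- A Borel set with open sections is a countable union of Borel rectangles with open sides. -/
theorem exists_eq_iUnion_prod_of_isOpen_sec {Q : Set (X × Y)} (hQ : MeasurableSet Q)
    (ho : ∀ x, IsOpen (sec Q x)) :
    ∃ (B : ℕ → Set X) (V : ℕ → Set Y), (∀ n, MeasurableSet (B n)) ∧ (∀ n, IsOpen (V n)) ∧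
      Q = ⋃ n, B n ×ˢ V n := by
  obtain ⟨V, hV, hVb⟩ := exists_seq_isOpen_closure_subset Y
  have hA : ∀ n, AnalyticSet {x | (sec Qᶜ x ∩ V n).Nonempty} := fun n =>
    AnalyticSet.nonempty_sec_inter hQ.compl.analyticSet (hV n).measurableSet.analyticSet
  -- A point of `Q` avoids the `n`-th set exactly when `V n` is a neighbourhood of its second
  -- coordinate contained in the section.
  obtain ⟨C, hC, hCu⟩ := exists_measurableSet_disjoint_iUnion_eq_univ
    (A := fun n => Q ∩ (Prod.fst ⁻¹' {x | (sec Qᶜ x ∩ V n).Nonempty} ∪ Prod.snd ⁻¹' (V n)ᶜ))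
    (fun n => AnalyticSet.inter hQ.analyticSet (AnalyticSet.union ((hA n).preimage continuous_fst)
      (measurable_snd (hV n).measurableSet.compl).analyticSet)) (by
    refine eq_empty_of_forall_notMem fun p hp => ?_
    have hp := mem_iInter.1 hp
    obtain ⟨n, hn, hnQ⟩ := hVb _ (ho p.1) p.2 (hp 0).1
    rcases (hp n).2 with ⟨y, hy, hyV⟩ | h
    · exact hy (hnQ (subset_closure hyV))
    · exact h hn)
  have hsep : ∀ n, ∃ B, MeasurableSet B ∧ (∀ p ∈ C n ∩ Q, p.1 ∈ B) ∧
      ∀ x ∈ B, V n ⊆ sec Q x := by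
    intro n
    obtain ⟨B, hB, hBA, hBm⟩ := (((hC n).1.inter hQ).analyticSet.image_of_continuous
      continuous_fst).measurablySeparable (hA n) (disjoint_left.2 (by
        rintro _ ⟨p, hp, rfl⟩ h
        exact disjoint_left.1 (hC n).2 hp.1 ⟨hp.2, Or.inl h⟩))
    refine ⟨B, hBm, fun p hp => hB ⟨p, hp, rfl⟩, fun x hx y hy => ?_⟩
    by_contra h
    exact disjoint_left.1 hBA ⟨y, h, hy⟩ hx
  choose B hB hCB hBV using hsep
  refine ⟨B, V, hB, hV, Subset.antisymm (fun p hp => ?_)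
    (iUnion_subset fun n p hp => hBV n p.1 hp.1 hp.2)⟩
  obtain ⟨n, hn⟩ := mem_iUnion.1 (hCu ▸ mem_univ p)
  refine mem_iUnion.2 ⟨n, hCB n p ⟨hn, hp⟩, ?_⟩
  by_contra h
  exact disjoint_left.1 (hC n).2 hn ⟨hp, Or.inr h⟩

/-- The projection of a Borel set with compact sections is Borel. -/
theorem measurableSet_nonempty_sec [CompactSpace Y] {Q : Set (X × Y)}
    (hQ : MeasurableSet Q) (hc : ∀ x, IsClosed (sec Q x)) :
    MeasurableSet {x | (sec Q x).Nonempty} := by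
  obtain ⟨B, V, hB, hV, hQV⟩ :=
    exists_eq_iUnion_prod_of_isOpen_sec hQ.compl fun x => (hc x).isOpen_compl
  have hmem : ∀ x y, y ∉ sec Q x ↔ ∃ n, x ∈ B n ∧ y ∈ V n := fun x y => by
    have : (x, y) ∈ Qᶜ ↔ (x, y) ∈ ⋃ n, B n ×ˢ V n := by rw [hQV]
    simpa [sec] using this
  -- A section is empty iff the open rectangles cover the fibre; by compactness finitely many do,
  -- and there are only countably many finite index sets.
  have : {x | (sec Q x).Nonempty}ᶜ =
      ⋃ s ∈ {s : Finset ℕ | ⋃ n ∈ s, V n = univ}, ⋂ n ∈ s, B n := by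
    ext x
    simp only [mem_compl_iff, mem_ofPred_eq, mem_iUnion, mem_iInter, exists_prop,
      not_nonempty_iff_eq_empty]
    constructor
    · intro h
      have hcov : (univ : Set Y) ⊆ ⋃ n : {n // x ∈ B n}, V n := fun y _ => by
        obtain ⟨n, hn, hy⟩ := (hmem x y).1 (h ▸ notMem_empty y)
        exact mem_iUnion.2 ⟨⟨n, hn⟩, hy⟩
      obtain ⟨t, ht⟩ := isCompact_univ.elim_finite_subcover (fun n : {n // x ∈ B n} => V n)
        (fun n => hV n.1) hcov
      refine ⟨t.map (Function.Embedding.subtype _), univ_subset_iff.1 fun y hy => ?_, fun n hn => ?_⟩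
      · obtain ⟨n, hn, hy⟩ := mem_iUnion₂.1 (ht hy)
        exact mem_iUnion₂.2 ⟨n, by simp [hn, n.2], hy⟩
      · obtain ⟨m, -, rfl⟩ := Finset.mem_map.1 hn
        exact m.2
    · rintro ⟨s, hs, hx⟩
      refine eq_empty_of_forall_notMem fun y => (hmem x y).2 ?_
      obtain ⟨n, hn, hy⟩ := mem_iUnion₂.1 (hs ▸ mem_univ y)
      exact ⟨n, hx n hn, hy⟩
  rw [← MeasurableSet.compl_iff, this]
  exact .biUnion (to_countable _) fun s _ => .biInter (to_countable _) fun n _ => hB n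

end Projection

/-! ### Measurable selection and Baire category. -/

/-- A version of the Kuratowski–Ryll-Nardzewski selection theorem. -/
theorem exists_measurable_forall_mem_closure {Ω Y : Type*} [MeasurableSpace Ω]
    [TopologicalSpace Y] [PolishSpace Y] [MeasurableSpace Y] [BorelSpace Y] {N : Ω → Set Y}
    (hne : ∀ ω, (N ω).Nonempty)
    (hmeas : ∀ U, IsOpen U → MeasurableSet {ω | (N ω ∩ U).Nonempty}) :
    ∃ f : Ω → Y, Measurable f ∧ ∀ ω, f ω ∈ closure (N ω) := by
  classical
  let := TopologicalSpace.upgradeIsCompletelyMetrizable Y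
  rcases isEmpty_or_nonempty Ω with _ | ⟨⟨ω₀⟩⟩
  · exact ⟨isEmptyElim, measurable_of_empty _, isEmptyElim⟩
  have : Nonempty Y := (hne ω₀).to_type
  let d := TopologicalSpace.denseSeq Y
  have hd : DenseRange d := TopologicalSpace.denseRange_denseSeq Y
  let r : ℕ → ℝ := fun k => (1 / 2) ^ k
  have hr : ∀ k, 0 < r k := fun k => by positivity
  -- Stage `k` is a measurable choice of a dense point within `(1 / 2) ^ k` of `N ω`.
  let S : ℕ → Type _ := fun k =>
    {i : Ω → ℕ // Measurable i ∧ ∀ ω, (N ω ∩ Metric.ball (d (i ω)) (r k)).Nonempty}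
  have hball : ∀ (y : Y) (k : ℕ), ∃ m, y ∈ Metric.ball (d m) (r k) := fun y k =>
    hd.exists_dist_lt y (hr k)
  have start : Nonempty (S 0) := by
    have hp : ∀ ω, ∃ m, (N ω ∩ Metric.ball (d m) (r 0)).Nonempty := fun ω => by
      obtain ⟨y, hy⟩ := hne ω
      obtain ⟨m, hm⟩ := hball y 0
      exact ⟨m, y, hy, hm⟩
    exact ⟨⟨fun ω => Nat.find (hp ω), measurable_find hp fun m => hmeas _ Metric.isOpen_ball,
      fun ω => Nat.find_spec (hp ω)⟩⟩
  have step : ∀ k (i : S k), ∃ i' : S (k + 1), ∀ ω,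
      dist (d (i.1 ω)) (d (i'.1 ω)) ≤ 2 * (1 / 2) ^ k := by
    rintro k ⟨i, hi, hiN⟩
    have hp : ∀ ω, ∃ m, (N ω ∩ (Metric.ball (d (i ω)) (r k) ∩
        Metric.ball (d m) (r (k + 1)))).Nonempty := fun ω => by
      obtain ⟨y, hy, hyi⟩ := hiN ω
      obtain ⟨m, hm⟩ := hball y (k + 1)
      exact ⟨m, y, hy, hyi, hm⟩
    refine ⟨⟨fun ω => Nat.find (hp ω), measurable_find hp fun m => ?_, fun ω => ?_⟩, fun ω => ?_⟩
    · have : {ω | (N ω ∩ (Metric.ball (d (i ω)) (r k) ∩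
          Metric.ball (d m) (r (k + 1)))).Nonempty} = ⋃ j, i ⁻¹' {j} ∩
          {ω | (N ω ∩ (Metric.ball (d j) (r k) ∩ Metric.ball (d m) (r (k + 1)))).Nonempty} := by
        ext ω
        simp
      rw [this]
      exact .iUnion fun j => (hi (measurableSet_singleton j)).inter
        (hmeas _ (Metric.isOpen_ball.inter Metric.isOpen_ball))
    · exact (Nat.find_spec (hp ω)).mono (inter_subset_inter_right _ inter_subset_right)
    · obtain ⟨y, -, hy, hy'⟩ := Nat.find_spec (hp ω)
      have h₁ := Metric.mem_ball'.1 hy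
      have h₂ := Metric.mem_ball.1 hy'
      have h₃ : r (k + 1) ≤ r k := by
        simp only [r, pow_succ]
        linarith [hr k]
      calc dist (d (i ω)) (d (Nat.find (hp ω)))
          ≤ dist (d (i ω)) y + dist y (d (Nat.find (hp ω))) := dist_triangle _ _ _
        _ ≤ 2 * r k := by linarith
  choose next hnext using step
  let i : ∀ k, S k := fun k => Nat.rec start.some next k
  have hlim : ∀ ω, ∃ y, Tendsto (fun k => d ((i k).1 ω)) atTop (𝓝 y) := fun ω =>
    cauchySeq_tendsto_of_complete
      (cauchySeq_of_le_geometric (1 / 2) 2 (by norm_num) fun k => hnext k (i k) ω)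
  choose f hf using hlim
  refine ⟨f, measurable_of_tendsto_metrizable
    (fun k => (measurable_from_nat (f := d)).comp (i k).2.1) (tendsto_pi_nhds.2 hf), fun ω => ?_⟩
  choose y hyN hy using fun k => (i k).2.2 ω
  refine mem_closure_of_tendsto (f := y) (b := atTop) ?_ (Eventually.of_forall hyN)
  have hr0 : Tendsto r atTop (𝓝 0) :=
    tendsto_pow_atTop_nhds_zero_of_lt_one (by norm_num) (by norm_num)
  refine (hf ω).congr_dist (squeeze_zero (fun _ => dist_nonneg) (fun k => ?_) hr0)
  exact (Metric.mem_ball'.1 (hy k)).le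

/-- If countably many closed sets cover a nonempty `Gδ` set, then one of them contains a nonempty
relatively open subset of it. -/
theorem exists_isOpen_inter_subset_of_isGδ {Y : Type*} [TopologicalSpace Y] [PolishSpace Y]
    {G : Set Y} (hG : IsGδ G) (hne : G.Nonempty) {F : ℕ → Set Y} (hF : ∀ n, IsClosed (F n))
    (hGF : G ⊆ ⋃ n, F n) : ∃ n U, IsOpen U ∧ (G ∩ U).Nonempty ∧ closure G ∩ U ⊆ F n := by
  have : PolishSpace (closure G) := isClosed_closure.polishSpace
  have : Nonempty (closure G) := (hne.mono subset_closure).to_subtype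
  have hd : Dense ((↑) ⁻¹' G : Set (closure G)) := by
    simp [Subtype.dense_iff, inter_eq_right.mpr subset_closure]
  obtain ⟨y, hy⟩ := ((hG.preimage continuous_subtype_val).dense_iUnion_interior_of_closed hd
    (fun n => (hF n).preimage continuous_subtype_val)
    (by rw [← preimage_iUnion]; exact preimage_mono hGF)).nonempty
  obtain ⟨n, hn⟩ := mem_iUnion.1 hy
  obtain ⟨U, hU, hUn⟩ := isOpen_induced_iff.1
    (isOpen_interior (s := ((↑) ⁻¹' F n : Set (closure G))))
  have hyU : (y : Y) ∈ U := by rwa [← hUn] at hn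
  refine ⟨n, U, hU, ?_, fun z hz => ?_⟩
  · rw [inter_comm]
    exact mem_closure_iff.1 y.2 U hU hyU
  · have : (⟨z, hz.1⟩ : closure G) ∈ (↑) ⁻¹' U := hz.2
    rw [hUn] at this
    exact interior_subset (s := ((↑) ⁻¹' F n : Set (closure G))) this

/-! ### The uniformization scheme and its three applications. -/

section Uniformization

variable {X Y : Type*} [TopologicalSpace X] [PolishSpace X] [MeasurableSpace X] [BorelSpace X]
  [TopologicalSpace Y] [PolishSpace Y] [MeasurableSpace Y] [BorelSpace Y]
  {E : Setoid X} {P : Set (X × Y)}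

/-- If an invariant family of closed sets `K x` has, for every `x`, a nonempty relatively open part
inside `P x`, and the hitting sets of such parts are Borel, then `P` has a Borel invariant
uniformization. -/
theorem exists_uniformization_of_locally_subset (hE : IsBorelEquiv E) (hP : MeasurableSet P)
    (hPE : IsInvariantSet E P) {K : Set (X × Y)} (hK : AnalyticSet K) (hKE : IsInvariantSet E K)
    (hKc : ∀ x, IsClosed (sec K x))
    (hcover : ∀ x, ∃ U, IsOpen U ∧ (sec K x ∩ U).Nonempty ∧ sec K x ∩ U ⊆ sec P x)
    (hmeas : ∀ U, IsOpen U → ∀ C, MeasurableSet C → (∀ x ∈ C, sec K x ∩ U ⊆ sec P x) →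
      MeasurableSet (C ∩ {x | (sec K x ∩ U).Nonempty})) :
    ∃ f : X → Y, IsBorelInvariantUniformization E P f := by
  classical
  obtain ⟨V, hV, hVb⟩ := exists_seq_isOpen_closure_subset Y
  have hopen : ∀ n U, IsOpen U → U ⊆ V n → ∀ C, MeasurableSet C →
      (∀ x ∈ C, sec K x ∩ closure (V n) ⊆ sec P x) →
      MeasurableSet (C ∩ {x | (sec K x ∩ U).Nonempty}) := by
    intro n U hU hUV C hC hCP
    exact hmeas U hU C hC fun x hx =>
      (inter_subset_inter_right _ (hUV.trans subset_closure)).trans (hCP x hx)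
  let R : ℕ → Set X := fun n => {x | (sec K x ∩ V n).Nonempty}
  let R' : ℕ → Set X := fun n => {x | (sec (K \ P) x ∩ closure (V n)).Nonempty}
  have hsub : ∀ n x, x ∉ R' n → sec K x ∩ closure (V n) ⊆ sec P x := fun n x hx y hy => by
    by_contra h
    exact hx ⟨y, ⟨hy.1, h⟩, hy.2⟩
  have hRE : ∀ n x y, E x y → x ∈ R n → y ∈ R n := fun n x y h hx => by
    simpa only [R, mem_ofPred_eq, ← hKE x y h] using hx
  have hRE' : ∀ n x y, E x y → x ∈ R' n → y ∈ R' n := fun n x y h hx => by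
    have : sec (K \ P) x = sec (K \ P) y := by
      change sec K x \ sec P x = sec K y \ sec P y
      rw [hKE x y h, hPE x y h]
    simpa only [R', mem_ofPred_eq, ← this] using hx
  obtain ⟨B, hB, hBc⟩ := exists_measurableSet_invariant_cover hE (R := R) (R' := R')
    (fun n => AnalyticSet.nonempty_sec_inter hK (hV n).measurableSet.analyticSet)
    (fun n => AnalyticSet.nonempty_sec_inter (AnalyticSet.diff_measurableSet hK hP)
      isClosed_closure.analyticSet) hRE hRE'
    (fun x => by
      obtain ⟨U, hU, ⟨y, hyK, hyU⟩, hUP⟩ := hcover x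
      obtain ⟨n, hn, hnU⟩ := hVb U hU y hyU
      exact ⟨n, ⟨y, hyK, hn⟩, fun ⟨z, hz, hzV⟩ => hz.2 (hUP ⟨hz.1, hnU hzV⟩)⟩)
    (fun n C hC hCd => hopen n (V n) (hV n) subset_rfl C hC fun x hx =>
      hsub n x (disjoint_left.1 hCd hx))
  let idx : X → ℕ := fun x => Nat.find (hBc x)
  have hidx : ∀ x, x ∈ B (idx x) := fun x => Nat.find_spec (hBc x)
  have hidxE : ∀ x y, E x y → idx x = idx y := fun x y h => by
    have : ∀ n, x ∈ B n ↔ y ∈ B n := fun n =>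
      ⟨(hB n).2.2.2 x y h, (hB n).2.2.2 y x (E.symm h)⟩
    simp only [idx, this]
  have hidxm : Measurable idx := measurable_find hBc fun n => (hB n).1
  -- Selecting on the quotient, with its quotient σ-algebra, makes the uniformization invariant
  -- automatically.
  let N : Quotient E → Set Y := Quotient.lift (fun x => sec K x ∩ V (idx x)) fun x y h => by
    simp only [hKE x y h, hidxE x y h]
  obtain ⟨f, hf, hfN⟩ := exists_measurable_forall_mem_closure (N := N)
    (fun q => q.inductionOn fun x => (hB _).2.1 (hidx x)) (fun U hU => by
      rw [measurableSet_quotient]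
      have : Quotient.mk'' ⁻¹' {q | (N q ∩ U).Nonempty} =
          ⋃ n, idx ⁻¹' {n} ∩ (B n ∩ {x | (sec K x ∩ (V n ∩ U)).Nonempty}) := by
        ext x
        simp only [mem_iUnion, mem_inter_iff, mem_preimage, mem_singleton_iff]
        refine ⟨fun h => ⟨idx x, rfl, hidx x, ?_⟩, ?_⟩
        · rwa [mem_ofPred_eq, ← inter_assoc]
        · rintro ⟨n, rfl, -, h⟩
          rwa [mem_ofPred_eq, ← inter_assoc] at h
      rw [this]
      exact .iUnion fun n => (hidxm (measurableSet_singleton n)).inter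
        (hopen n _ ((hV n).inter hU) inter_subset_left (B n) (hB n).1 fun x hx =>
          hsub n x (disjoint_left.1 (hB n).2.2.1 hx)))
  refine ⟨fun x => f (Quotient.mk'' x), hf.comp measurable_quotient_mk'', fun x => ?_,
    fun x y h => congrArg f (Quotient.sound h)⟩
  refine hsub (idx x) x (disjoint_left.1 (hB _).2.2.1 (hidx x)) ?_
  have := hfN (Quotient.mk'' x)
  exact ⟨(hKc x).closure_subset_iff.2 inter_subset_left this, closure_mono inter_subset_right this⟩

/-- With `K x` the whole space, a non-meager `F_σ` section has a closed piece with interior. -/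
theorem exists_uniformization_of_isFSigma_not_isMeagre (hE : IsBorelEquiv E)
    (hP : MeasurableSet P) (hPE : IsInvariantSet E P)
    (h : ∀ x, IsFSigma (sec P x) ∧ ¬ IsMeagre (sec P x)) :
    ∃ f : X → Y, IsBorelInvariantUniformization E P f := by
  refine exists_uniformization_of_locally_subset hE hP hPE (K := univ)
    MeasurableSet.univ.analyticSet (fun _ _ _ => rfl) (fun _ => isClosed_univ) (fun x => ?_)
    (fun U _ C hC _ => hC.inter ?_)
  · obtain ⟨⟨F, hF, hPF⟩, hm⟩ := h x
    by_contra! hU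
    refine hm (hPF ▸ isMeagre_iUnion fun n => ?_)
    refine IsNowhereDense.isMeagre ((hF n).isNowhereDense_iff.2 ?_)
    by_contra hne
    obtain ⟨y, hy⟩ := nonempty_iff_ne_empty.2 hne
    refine hU _ isOpen_interior ⟨y, mem_univ y, hy⟩ fun z hz => ?_
    rw [hPF]
    exact mem_iUnion.2 ⟨n, interior_subset hz.2⟩
  · exact .const (univ ∩ U).Nonempty

/-- The support `K x` meets an open set iff that set has positive measure inside `P x`, so hitting
sets are Borel. `P x ∩ K x` is `G_δ` and dense in `K x`, so Baire category applies to the closed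
pieces of `P x`. -/
theorem exists_uniformization_of_measure_pos (hE : IsBorelEquiv E)
    (hP : MeasurableSet P) (hPE : IsInvariantSet E P) {μ : X → ProbabilityMeasure Y}
    (hμ : Measurable μ) (hμE : IsInvariantMap E μ)
    (h : ∀ x, IsDeltaTwo (sec P x) ∧ 0 < (μ x : Measure Y) (sec P x)) :
    ∃ f : X → Y, IsBorelInvariantUniformization E P f := by
  obtain ⟨V, hV, hVb⟩ := exists_seq_isOpen_closure_subset Y
  let κ : ProbabilityTheory.Kernel X Y := ⟨fun x => (μ x : Measure Y), measurable_subtype_coe.comp hμ⟩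
  have : ProbabilityTheory.IsMarkovKernel κ :=
    ⟨fun x => inferInstanceAs (IsProbabilityMeasure (μ x : Measure Y))⟩
  have hpos : ∀ U, MeasurableSet U →
      MeasurableSet {x | 0 < (μ x : Measure Y) (sec P x ∩ U)} := fun U hU =>
    measurableSet_lt measurable_const
      (ProbabilityTheory.Kernel.measurable_kernel_prodMk_left (κ := κ)
        (hP.inter (measurable_snd hU)))
  -- the support of the restriction of `μ x` to the section
  let K : Set (X × Y) := ⋂ n, {p | p.2 ∈ V n → 0 < (μ p.1 : Measure Y) (sec P p.1 ∩ V n)}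
  have hmemK : ∀ x y, y ∈ sec K x ↔ ∀ U, IsOpen U → y ∈ U → 0 < (μ x : Measure Y) (sec P x ∩ U) := by
    intro x y
    have : y ∈ sec K x ↔ ∀ n, y ∈ V n → 0 < (μ x : Measure Y) (sec P x ∩ V n) := mem_iInter
    rw [this]
    refine ⟨fun h U hU hy => ?_, fun h n hn => h _ (hV n) hn⟩
    obtain ⟨n, hn, hnU⟩ := hVb U hU y hy
    exact (h n hn).trans_le (measure_mono (inter_subset_inter_right _ (subset_closure.trans hnU)))
  have hKm : MeasurableSet K := .iInter fun n => by
    have : {p : X × Y | p.2 ∈ V n → 0 < (μ p.1 : Measure Y) (sec P p.1 ∩ V n)} =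
        Prod.snd ⁻¹' (V n)ᶜ ∪ Prod.fst ⁻¹' {x | 0 < (μ x : Measure Y) (sec P x ∩ V n)} := by
      ext p
      exact imp_iff_not_or
    rw [this]
    exact (measurable_snd (hV n).measurableSet.compl).union
      (measurable_fst (hpos _ (hV n).measurableSet))
  have hKc : ∀ x, IsClosed (sec K x) := fun x => by
    refine isClosed_of_closure_subset fun y hy => (hmemK x y).2 fun U hU hyU => ?_
    obtain ⟨z, hzU, hz⟩ := mem_closure_iff.1 hy U hU hyU
    exact (hmemK x z).1 hz U hU hzU
  have hnull : ∀ x, (μ x : Measure Y) (sec P x \ sec K x) = 0 := fun x => by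
    refine measure_mono_null (t := ⋃ n ∈ {n | (μ x : Measure Y) (sec P x ∩ V n) = 0},
      sec P x ∩ V n) (fun y hy => ?_) ((measure_biUnion_null_iff (to_countable _)).2 fun n hn => hn)
    have : ¬ ∀ n, y ∈ V n → 0 < (μ x : Measure Y) (sec P x ∩ V n) := fun h => hy.2 (mem_iInter.2 h)
    push Not at this
    obtain ⟨n, hn, h0⟩ := this
    exact mem_iUnion₂.2 ⟨n, nonpos_iff_eq_zero.1 h0, hy.1, hn⟩
  have hhit : ∀ x U, 0 < (μ x : Measure Y) (sec P x ∩ U) → (sec P x ∩ sec K x ∩ U).Nonempty := by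
    intro x U hU
    by_contra hne
    have hsub : sec P x ∩ U ⊆ sec P x \ sec K x :=
      fun y hy => ⟨hy.1, fun hyK => hne ⟨y, ⟨hy.1, hyK⟩, hy.2⟩⟩
    exact hU.ne' (measure_mono_null hsub (hnull x))
  have hhit_iff : ∀ x U, IsOpen U →
      ((sec K x ∩ U).Nonempty ↔ 0 < (μ x : Measure Y) (sec P x ∩ U)) := fun x U hU =>
    ⟨fun ⟨y, hy, hyU⟩ => (hmemK x y).1 hy U hU hyU,
      fun h => (hhit x U h).mono (inter_subset_inter_left _ inter_subset_right)⟩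
  have hKE : IsInvariantSet E K := fun x₁ x₂ hx => by
    ext y
    rw [hmemK, hmemK, hPE x₁ x₂ hx, hμE x₁ x₂ hx]
  refine exists_uniformization_of_locally_subset hE hP hPE hKm.analyticSet hKE hKc (fun x => ?_)
    (fun U hU C hC _ => hC.inter ?_)
  · obtain ⟨⟨⟨F, hF, hPF⟩, hG⟩, hx⟩ := h x
    have hd : sec K x ⊆ closure (sec P x ∩ sec K x) := fun y hy => by
      refine mem_closure_iff.2 fun U hU hyU => ?_
      rw [inter_comm]
      exact hhit x U ((hmemK x y).1 hy U hU hyU)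
    obtain ⟨n, U, hU, hne, hUF⟩ := exists_isOpen_inter_subset_of_isGδ
      (hG.inter (hKc x).isGδ) ((hhit x univ (by rwa [inter_univ])).mono inter_subset_left) hF
      (hPF ▸ inter_subset_left)
    refine ⟨U, hU, hne.mono (inter_subset_inter_left _ inter_subset_right), ?_⟩
    refine ((inter_subset_inter_left _ hd).trans hUF).trans ?_
    rw [hPF]
    exact subset_iUnion F n
  · simp only [hhit_iff _ U hU]
    exact hpos U hU.measurableSet

/-- Here `K` is only analytic. Working in the Hilbert cube makes closed sections compact, so that
the relevant hitting sets are Borel as projections. -/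
theorem exists_uniformization_of_isGδ_isSigmaCompact (hE : IsBorelEquiv E)
    (hP : MeasurableSet P) (hPE : IsInvariantSet E P)
    (h : ∀ x, IsGδ (sec P x) ∧ (sec P x).Nonempty ∧ IsSigmaCompact (sec P x)) :
    ∃ f : X → Y, IsBorelInvariantUniformization E P f := by
  let := TopologicalSpace.upgradeIsCompletelyMetrizable Y
  obtain ⟨e, he⟩ := Metric.PiNatEmbed.exists_embedding_to_hilbert_cube (X := Y)
  have hem : MeasurableEmbedding e := he.continuous.measurableEmbedding he.injective
  let Q : Set (X × (ℕ → unitInterval)) := Prod.map id e '' P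
  have hQ : MeasurableSet Q := (MeasurableEmbedding.id.prodMap hem).measurableSet_image.2 hP
  have hsec : ∀ x, sec Q x = e '' sec P x := fun x => by
    ext z
    constructor
    · rintro ⟨⟨x', y⟩, hy, hxy⟩
      obtain ⟨rfl, rfl⟩ := Prod.mk.inj hxy
      exact ⟨y, hy, rfl⟩
    · rintro ⟨y, hy, rfl⟩
      exact ⟨(x, y), hy, rfl⟩
  have hQE : IsInvariantSet E Q := fun x₁ x₂ hx => by rw [hsec, hsec, hPE x₁ x₂ hx]
  obtain ⟨V, hV, hVb⟩ := exists_seq_isOpen_closure_subset (ℕ → unitInterval)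
  let K : Set (X × (ℕ → unitInterval)) := {p | p.2 ∈ closure (sec Q p.1)}
  have hsecK : ∀ x, sec K x = closure (sec Q x) := fun x => rfl
  have hK : AnalyticSet K := by
    have : K = ⋂ n, (Prod.snd ⁻¹' (V n)ᶜ ∪ Prod.fst ⁻¹' {x | (sec Q x ∩ V n).Nonempty}) := by
      ext p
      simp only [K, mem_iInter, mem_ofPred_eq, mem_closure_iff]
      refine ⟨fun h n => ?_, fun h U hU hp => ?_⟩
      · by_cases hp : p.2 ∈ V n
        · exact Or.inr (by simpa only [inter_comm] using! h _ (hV n) hp)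
        · exact Or.inl hp
      · obtain ⟨n, hn, hnU⟩ := hVb U hU p.2 hp
        obtain ⟨z, hz, hzV⟩ := (h n).resolve_left fun h => h hn
        exact ⟨z, hnU (subset_closure hzV), hz⟩
    rw [this]
    exact AnalyticSet.iInter fun n => AnalyticSet.union
      (measurable_snd (hV n).measurableSet.compl).analyticSet
      ((AnalyticSet.nonempty_sec_inter hQ.analyticSet (hV n).measurableSet.analyticSet).preimage
        continuous_fst)
  obtain ⟨g, hg⟩ : ∃ g, IsBorelInvariantUniformization E Q g := by
    refine exists_uniformization_of_locally_subset hE hQ hQE hK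
      (fun x₁ x₂ hx => by rw [hsecK, hsecK, hQE x₁ x₂ hx])
      (fun x => (isClosed_closure : IsClosed (closure (sec Q x)))) (fun x => ?_)
      (fun U hU C hC hCQ => ?_)
    · obtain ⟨hG, hne, F, hF, hFP⟩ := h x
      obtain ⟨n, U, hU, ⟨y, hyP, hyU⟩, hUF⟩ := exists_isOpen_inter_subset_of_isGδ hG hne
        (fun n => (hF n).isClosed) hFP.ge
      obtain ⟨W, hW, rfl⟩ := he.isOpen_iff.1 hU
      refine ⟨W, hW, ⟨e y, subset_closure (hsec x ▸ mem_image_of_mem e hyP), hyU⟩, ?_⟩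
      have hsub : sec Q x ∩ W ⊆ e '' F n := by
        rw [hsec]
        rintro _ ⟨⟨z, hz, rfl⟩, hzW⟩
        exact ⟨z, hUF ⟨subset_closure hz, hzW⟩, rfl⟩
      -- Compactness of `F n` keeps its image closed in the cube, so passing to the closure adds no
      -- point outside `sec Q x`.
      refine hW.closure_inter.trans ((closure_minimal hsub
        ((hF n).image he.continuous).isClosed).trans ?_)
      rw [hsec, ← hFP]
      exact image_mono (subset_iUnion F n)
    · let := TopologicalSpace.upgradeIsCompletelyMetrizable (ℕ → unitInterval)
      -- Over `C` the sets `K x` and `Q x` agree inside `U`; cutting by the closed pieces `F m` of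
      -- `U` gives a Borel set with compact sections.
      obtain ⟨F, hF, hFU, rfl, -⟩ := hU.exists_iUnion_isClosed
      have : C ∩ {x | (sec K x ∩ ⋃ m, F m).Nonempty} =
          ⋃ m, {x | (sec (Q ∩ C ×ˢ F m) x).Nonempty} := by
        ext x
        simp only [mem_inter_iff, mem_iUnion, mem_ofPred_eq]
        constructor
        · rintro ⟨hx, z, hz, hzF⟩
          obtain ⟨m, hm⟩ := mem_iUnion.1 hzF
          exact ⟨m, z, hCQ x hx ⟨hz, hzF⟩, hx, hm⟩
        · rintro ⟨m, z, hz, hx, hm⟩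
          exact ⟨hx, z, subset_closure hz, mem_iUnion.2 ⟨m, hm⟩⟩
      rw [this]
      refine .iUnion fun m => measurableSet_nonempty_sec
        (hQ.inter (hC.prod (hF m).measurableSet)) fun x => ?_
      by_cases hx : x ∈ C
      · have : sec (Q ∩ C ×ˢ F m) x = sec K x ∩ F m := by
          ext z
          exact ⟨fun hz => ⟨subset_closure hz.1, hz.2.2⟩,
            fun hz => ⟨hCQ x hx ⟨hz.1, hFU m hz.2⟩, hx, hz.2⟩⟩
        rw [this]
        exact (isClosed_closure : IsClosed (closure (sec Q x))).inter (hF m)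
      · have : sec (Q ∩ C ×ˢ F m) x = ∅ := eq_empty_of_forall_notMem fun z hz => hx hz.2.1
        rw [this]
        exact isClosed_empty
  choose f hf hfg using fun x => (hsec x ▸ hg.mem x : g x ∈ e '' sec P x)
  have hfg' : e ∘ f = g := funext hfg
  exact ⟨f, hem.measurable_comp_iff.1 (hfg' ▸ hg.measurable), hf,
    fun x₁ x₂ hx => he.injective (by rw [hfg, hfg, hg.invariant x₁ x₂ hx])⟩

end Uniformization

end InvUnif

theorem mainTheorem3 {X Y : Type*}
    [TopologicalSpace X] [PolishSpace X] [MeasurableSpace X] [BorelSpace X]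
    [TopologicalSpace Y] [PolishSpace Y] [MeasurableSpace Y] [BorelSpace Y]
    (E : Setoid X) (hE : InvUnif.IsBorelEquiv E)
    (P : Set (X × Y)) (hP : MeasurableSet P) (hPE : InvUnif.IsInvariantSet E P)
    (h :
      (∃ μ : X → ProbabilityMeasure Y, Measurable μ ∧ InvUnif.IsInvariantMap E μ ∧
        ∀ x : X, InvUnif.IsDeltaTwo (InvUnif.sec P x) ∧
          0 < (μ x : Measure Y) (InvUnif.sec P x)) ∨
      (∀ x : X, InvUnif.IsFSigma (InvUnif.sec P x) ∧ ¬ IsMeagre (InvUnif.sec P x)) ∨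
      (∀ x : X, IsGδ (InvUnif.sec P x) ∧ (InvUnif.sec P x).Nonempty ∧
        IsSigmaCompact (InvUnif.sec P x))) :
    ∃ f : X → Y, InvUnif.IsBorelInvariantUniformization E P f := by
  rcases h with ⟨μ, hμ, hμE, h⟩ | h | h
  · exact InvUnif.exists_uniformization_of_measure_pos hE hP hPE hμ hμE h
  · exact InvUnif.exists_uniformization_of_isFSigma_not_isMeagre hE hP hPE h
  · exact InvUnif.exists_uniformization_of_isGδ_isSigmaCompact hE hP hPE h
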